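/- Let $D \ge 0$ be an integer and $\mathcal H_N = (\mathbb C^{D+1})^{\otimes N}$. For each $N\ge 1$ let $|\psi_N\rangle \in \mathcal H_N$ be a nonzero vector that is invariant under all permutations of the $N$ sites, and let $\psi_N(\mathcal O) = \langle\psi_N|\mathcal O|\psi_N\rangle/\langle\psi_N|\psi_N\rangle$ be its quantum state. Operators $\mathcal O\in \mathrm{End}(\mathcal H_k)$ (the finitely-supported operators) are embedded in $\mathrm{End}(\mathcal H_N)$, $N\ge k$, as $\mathcal O\otimes \mathbf 1$. Suppose that $\psi_N$ converges to $\psi$ in the local-operator topology, that is, $\lim_{N\to\infty}\psi_N(\mathcal O)=\psi(\mathcal O)$ for every $k$ and every $\mathcal O\in\mathrm{End}(\mathcal H_k)$. For $v \in \mathbb{CP}^D$ (in homogeneous coordinates) let $\psi_v$ be the state of the product vectors $v\otimes\cdots\otimes v$. Then there is a Borel probability measure $\mu$ on $\mathbb{CP}^D$ with $\psi(\mathcal O)=\int_{\mathbb{CP}^D} d\mu(v)\,\psi_v(\mathcal O)$ for every finitely-supported $\mathcal O$. For every such $\mu$, every integer $n>1$ and every integer $m\ge 0$, the integral $$I = \int_{(\mathbb{CP}^D)^{n}}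 \Big(\prod_{\alpha=1}^n d\mu(v_\alpha)\Big)\Big(\prod_{\alpha=1}^n \frac{v_\alpha^\dagger v_{\alpha+1}}{v_\alpha^\dagger v_\alpha}\Big)^m,\qquad v_{n+1}:=v_1,$$ converges absolutely and is real and positive. Moreover, for every choice of sets of sites $A_N\subseteq\{1,\dots,N\}$ with $|A_N|=m$ for all sufficiently large $N$, the Rényi entropies $\frac{1}{1-n}\log \mathrm{Tr}\,\rho_{A_N}^n$ converge as $N\to\infty$ to $$S_n=\frac{1}{1-n}\log I ,$$ where $\rho_{A_N}$ is the partial trace of $|\psi_N\rangle\langle\psi_N|/\langle\psi_N|\psi_N\rangle$ over the sites outside $A_N$. -/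

import Mathlib

open MeasureTheory Filter Topology
open scoped Matrix LinearAlgebra.Projectivization

noncomputable section

namespace PermSymm

/-- Basis configurations of the local space `ℂ^(D+1)` on a set `ι` of sites. -/
abbrev Config (D : ℕ) (ι : Type) : Type := ι → Fin (D + 1)

/-- The Hilbert space `H_N = (ℂ^(D+1))^{⊗ N}`, written in coordinates with respect to the product
basis, which is orthonormal; thus `⟨φ|ψ⟩ = star φ ⬝ᵥ ψ`. -/
abbrev Hilb (D N : ℕ) : Type := Config D (Fin N) → ℂ

/-- `End(H_N)`, written as matrices with respect to the product basis. -/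
abbrev Op (D N : ℕ) : Type := Matrix (Config D (Fin N)) (Config D (Fin N)) ℂ

/-- Vectors that are symmetric under all permutations of sites (the subspace `P_N` of `H_N`). -/
def IsSymmetric {D N : ℕ} (φ : Hilb D N) : Prop :=
  ∀ (σ : Equiv.Perm (Fin N)) (x : Config D (Fin N)), φ (x ∘ σ) = φ x

/-- The quantum state `O ↦ ⟨φ|O|φ⟩ / ⟨φ|φ⟩` on `End(H_N)` given by a vector `φ`. -/
def pureState {D N : ℕ} (φ : Hilb D N) : Op D N →ₗ[ℂ] ℂ where
  toFun O := (star φ ⬝ᵥ O *ᵥ φ) / (star φ ⬝ᵥ φ)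
  map_add' O O' := by
    rw [Matrix.add_mulVec, dotProduct_add, add_div]
  map_smul' c O := by
    rw [Matrix.smul_mulVec, dotProduct_smul, smul_div_assoc, RingHom.id_apply]

/-- The embedding `O ↦ O ⊗ 1` of `End(H_k)` into `End(H_N)`, `k ≤ N`: the operator `O` acts on the
first `k` sites and the identity acts on the others. -/
def embedOp {D k N : ℕ} (h : k ≤ N) (O : Op D k) : Op D N :=
  Matrix.of fun x y =>
    if ∀ j : Fin N, k ≤ (j : ℕ) → x j = y j then O (x ∘ Fin.castLE h) (y ∘ Fin.castLE h) else 0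

/-- Linear functionals on finitely-supported operators, given on each `End(H_k)`. -/
abbrev LocalFunctional (D : ℕ) : Type := ∀ k : ℕ, Op D k →ₗ[ℂ] ℂ

/-- Convergence of the states of the vectors `Φ N` to `ψ` in the local-operator topology: the
expectation values of every finitely-supported operator converge. (The terms with `N < k`, where
`O` cannot be embedded, are irrelevant for the limit.) -/
def ConvergesLocally {D : ℕ} (Φ : ∀ N : ℕ, Hilb D N) (ψ : LocalFunctional D) : Prop :=
  ∀ (k : ℕ) (O : Op D k),
    Tendsto (fun N : ℕ => if h : k ≤ N then pureState (Φ N) (embedOp h O) else 0)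
      atTop (𝓝 (ψ k O))

/-- Complex projective space `ℂP^D`. -/
abbrev CP (D : ℕ) : Type := ℙ ℂ (Fin (D + 1) → ℂ)

/-- The usual topology of `ℂP^D`: the quotient topology of `ℂ^(D+1) ∖ {0}`. -/
instance instTopologicalSpaceCP (D : ℕ) : TopologicalSpace (CP D) :=
  TopologicalSpace.coinduced
    (Projectivization.mk' ℂ : {v : Fin (D + 1) → ℂ // v ≠ 0} → CP D) inferInstance

/-- Measures on `ℂP^D` are Borel measures. -/
instance instMeasurableSpaceCP (D : ℕ) : MeasurableSpace (CP D) := borel (CP D)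

instance instBorelSpaceCP (D : ℕ) : BorelSpace (CP D) := ⟨rfl⟩

/-- The zero-entanglement vector `|v, v, …, v⟩` on `N` sites. -/
def productVec {D : ℕ} (v : Fin (D + 1) → ℂ) (N : ℕ) : Hilb D N := fun x => ∏ j, v (x j)

/-- The zero-entanglement state `ψ_v`, `v ∈ ℂP^D`, in the thermodynamic limit. On `End(H_k)` it is
the state of `|v, …, v⟩` on `k` sites, since `⟨v…v|O ⊗ 1|v…v⟩ / ⟨v…v|v…v⟩` does not depend on the
number of sites where the identity acts, nor on the representative of `v`. -/
def zeroEntState {D : ℕ} (v : CP D) : LocalFunctional D := fun k => pureState (productVec v.rep k)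

/-- `ψ(O) = ∫ dμ(v) ψ_v(O)` for every finitely-supported operator `O`. -/
def Represents {D : ℕ} (μ : Measure (CP D)) (ψ : LocalFunctional D) : Prop :=
  ∀ (k : ℕ) (O : Op D k), ψ k O = ∫ v, zeroEntState v k O ∂μ

/-- The density matrix `|φ⟩⟨φ| / ⟨φ|φ⟩`. -/
def density {D N : ℕ} (φ : Hilb D N) : Op D N :=
  (star φ ⬝ᵥ φ)⁻¹ • Matrix.vecMulVec φ (star φ)

/-- The configuration which is `a` on the sites in `A` and `c` on the other sites. -/
def glue {D N : ℕ} (A : Finset (Fin N)) (a : Config D {j // j ∈ A}) (c : Config D {j // j ∉ A}) :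
    Config D (Fin N) :=
  fun j => if h : j ∈ A then a ⟨j, h⟩ else c ⟨j, h⟩

/-- The reduced density matrix `ρ_A` of the set of sites `A`: the partial trace of the density
matrix over the sites outside `A`. -/
def reducedDensity {D N : ℕ} (A : Finset (Fin N)) (φ : Hilb D N) :
    Matrix (Config D {j // j ∈ A}) (Config D {j // j ∈ A}) ℂ :=
  Matrix.of fun a b => ∑ c : Config D {j // j ∉ A}, density φ (glue A a c) (glue A b c)

/-- The Rényi entropy `S_n = log (Tr ρ_A^n) / (1 - n)` of the bipartition of the sites into `A` and
its complement. (The trace is real.) -/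
def renyi {D N : ℕ} (n : ℕ) (A : Finset (Fin N)) (φ : Hilb D N) : ℝ :=
  Real.log ((reducedDensity A φ ^ n).trace.re) / (1 - (n : ℝ))

/-- The integrand `(∏_α v_α† v_{α+1} / v_α† v_α)^m` on `(ℂP^D)^n`, with `v_{n+1} = v_1`; here
`finRotate n` is the cyclic successor on `Fin n`. It does not depend on the representatives. -/
def replicaIntegrand {D : ℕ} (n m : ℕ) (v : Fin n → CP D) : ℂ :=
  (∏ α : Fin n, (star (v α).rep ⬝ᵥ (v (finRotate n α)).rep) / (star (v α).rep ⬝ᵥ (v α).rep)) ^ m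

end PermSymm

end

/-! The limit functional is determined by its matrices on `k` sites, which form a compatible family
`ρ` of Bose-symmetric density matrices (`limitFamily_mem_boseStates`). Such families form a compact
convex set in a product of copies of `ℂ`, so Krein–Milman applies once the extreme points are known.

Testing the first site against a small vector `u` leaves a family `slice u ρ` with `ρ - slice u ρ`
still positive (`IsBoseFamily.sub_slice`). If `ρ` is extreme, `slice u ρ` is therefore a multiple of
`ρ`, so the first site is independent of the others and `ρ` is a product of copies of its one-site
matrix. Bose symmetry of the two-site matrix in the row indices alone makes the one-site matrix rank
one, so `ρ` comes from a product vector (`exists_eq_productFamily`). Mixtures of product states form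
a closed convex set, hence exhaust all states (`exists_mixture_eq`). The mixing measure is pushed
forward from the unit sphere to projective space.

For the entropies, `(v† w) ^ m` is an inner product of product vectors. Expanding the replica
integrand in the product basis and applying Fubini turns the integral into the trace of the `n`-th
power of the limiting `m`-site matrix (`integral_replicaIntegrand`), for any representing measure.
This trace is positive (`Matrix.PosSemidef.trace_pow_pos`), and it is the limit of the traces of
`ρ_A ^ n`, because permutation symmetry makes them depend on `A` only through its size
(`reducedDensity_pow_trace`). -/

/-! ### Trace bounds for positive semidefinite matrices. -/

namespace Matrix.PosSemidef

open scoped ComplexOrder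

/-- The off-diagonal entries of a positive semidefinite matrix are bounded by its trace. -/
theorem norm_apply_le_trace {n : Type*} [Fintype n] {M : Matrix n n ℂ} (hM : M.PosSemidef)
    (i j : n) : ‖M i j‖ ≤ M.trace.re := by
  classical
  have hdiag : ∀ k, 0 ≤ (M k k).re := fun k => (Complex.le_def.1 hM.diag_nonneg).1
  have htr : M.trace.re = ∑ k, (M k k).re := by simp [Matrix.trace]
  have hle : ∀ k, (M k k).re ≤ M.trace.re := fun k => by
    rw [htr]
    exact Finset.single_le_sum (f := fun k => (M k k).re) (fun k _ => hdiag k) (Finset.mem_univ k)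
  by_cases h0 : M i j = 0
  · rw [h0, norm_zero]
    exact (hdiag i).trans (hle i)
  have hn : (‖M i j‖ : ℂ) ≠ 0 := by simpa using h0
  have hji : M j i = star (M i j) := (hM.isHermitian.apply j i).symm
  -- This phase makes both cross terms of the quadratic form at `e_i + s e_j` equal to `-‖M i j‖`,
  -- so positivity gives `2 ‖M i j‖ ≤ M i i + M j j`.
  set s : ℂ := -(star (M i j) / ‖M i j‖) with hs
  have hms : M i j * star (M i j) = (‖M i j‖ : ℂ) ^ 2 := by
    simpa using Complex.mul_conj' (M i j)
  have hss : star s * s = 1 := by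
    rw [hs]
    simp only [star_neg, star_div₀, star_star]
    have : star (‖M i j‖ : ℂ) = ‖M i j‖ := Complex.conj_ofReal _
    rw [this, neg_mul_neg, div_mul_div_comm, hms, ← sq, div_self (pow_ne_zero 2 hn)]
  have hsm : M i j * s = -‖M i j‖ := by
    rw [hs, mul_neg, mul_div_assoc', hms, sq, mul_div_assoc, div_self hn, mul_one]
  have hsm' : star s * star (M i j) = -‖M i j‖ := by
    rw [← star_mul', mul_comm, hsm]
    simp
  have key := hM.dotProduct_mulVec_nonneg (Pi.single i 1 + s • Pi.single j 1)
  have expand : star (Pi.single i (1 : ℂ) + s • Pi.single j 1) ⬝ᵥ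
      M *ᵥ (Pi.single i 1 + s • Pi.single j 1) =
      M i i + M i j * s + star s * star (M i j) + star s * s * M j j := by
    rw [star_add, star_smul, add_dotProduct, smul_dotProduct, Matrix.mulVec_add, Matrix.mulVec_smul]
    simp only [← Pi.single_star, star_one, single_dotProduct, dotProduct_add, dotProduct_smul,
      Matrix.mulVec_single_one, Matrix.col_apply, smul_eq_mul, one_mul,
      hji]
    ring
  rw [expand, hss, hsm, hsm', Complex.le_def] at key
  have h1 := key.1
  simp only [Complex.zero_re, Complex.add_re, Complex.neg_re, Complex.ofReal_re, one_mul] at h1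
  linarith [hle i, hle j]

/-- The quadratic form of a positive semidefinite matrix is bounded by its trace on the unit ball
of `ℓ¹`. -/
theorem dotProduct_mulVec_re_le_trace {n : Type*} [Fintype n] {M : Matrix n n ℂ}
    (hM : M.PosSemidef) (u : n → ℂ) (hu : ∑ i, ‖u i‖ ≤ 1) :
    (star u ⬝ᵥ M *ᵥ u).re ≤ M.trace.re := by
  have htr : 0 ≤ M.trace.re := (Complex.le_def.1 hM.trace_nonneg).1
  calc (star u ⬝ᵥ M *ᵥ u).re ≤ ‖star u ⬝ᵥ M *ᵥ u‖ := Complex.re_le_norm _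
    _ ≤ ∑ i, ∑ j, ‖u i‖ * M.trace.re * ‖u j‖ := by
      simp only [dotProduct, Matrix.mulVec, Finset.mul_sum]
      refine (norm_sum_le _ _).trans (Finset.sum_le_sum fun i _ => (norm_sum_le _ _).trans
        (Finset.sum_le_sum fun j _ => ?_))
      rw [norm_mul, norm_mul, ← mul_assoc, Pi.star_apply, norm_star]
      gcongr
      exact hM.norm_apply_le_trace i j
    _ = (∑ i, ‖u i‖) ^ 2 * M.trace.re := by
      rw [sq, Finset.sum_mul_sum, Finset.sum_mul]
      refine Finset.sum_congr rfl fun i _ => ?_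
      rw [Finset.sum_mul]
      exact Finset.sum_congr rfl fun j _ => by ring
    _ ≤ M.trace.re := by
      refine mul_le_of_le_one_left htr (pow_le_one₀ (by positivity) hu)

end Matrix.PosSemidef

/-- A complex matrix whose quadratic form vanishes is zero. -/
theorem Matrix.eq_zero_of_dotProduct_mulVec_eq_zero {n : Type*} [Fintype n] {M : Matrix n n ℂ}
    (hM : ∀ u : n → ℂ, star u ⬝ᵥ M *ᵥ u = 0) : M = 0 := by
  classical
  have h := (inner_map_self_eq_zero (Matrix.toEuclideanLin M)).1 fun x => by
    rw [← inner_conj_symm]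
    have := hM x.ofLp
    rw [EuclideanSpace.inner_eq_star_dotProduct, Matrix.ofLp_toLpLin, Matrix.toLin'_apply,
      dotProduct_comm, this, map_zero]
  simpa using h

/-! ### Compatible bosonic families and their slices. -/

namespace PermSymm

open scoped ComplexOrder

variable {D : ℕ}

/-- The configuration on `k + 1` sites with `a` on the first site and `x` on the others. -/
abbrev consConfig {k : ℕ} (a : Fin (D + 1)) (x : Config D (Fin k)) : Config D (Fin (k + 1)) :=
  Fin.cons (α := fun _ => Fin (D + 1)) a x

/-- The configuration on `k + 1` sites with `a` on the last site and `x` on the others. -/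
abbrev snocConfig {k : ℕ} (x : Config D (Fin k)) (a : Fin (D + 1)) : Config D (Fin (k + 1)) :=
  Fin.snoc (α := fun _ => Fin (D + 1)) x a

theorem sum_consConfig {M : Type*} [AddCommMonoid M] {k : ℕ} (f : Config D (Fin (k + 1)) → M) :
    ∑ z, f z = ∑ a, ∑ x, f (consConfig a x) := by
  rw [← Fintype.sum_prod_type']
  exact ((Fin.consEquiv fun _ => Fin (D + 1)).sum_comp f).symm

theorem sum_snocConfig {M : Type*} [AddCommMonoid M] {k : ℕ} (f : Config D (Fin (k + 1)) → M) :
    ∑ z, f z = ∑ a, ∑ x, f (snocConfig x a) := by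
  rw [← Fintype.sum_prod_type']
  exact ((Fin.snocEquiv fun _ => Fin (D + 1)).sum_comp f).symm

/-- A family of matrix entries `⟨x|ρ_k|y⟩`, one matrix for each number `k` of sites. -/
abbrev MatrixFamily (D : ℕ) : Type := ∀ k : ℕ, Config D (Fin k) → Config D (Fin k) → ℂ

/-- Compatible families of unnormalised density matrices of bosonic sites: positive
semidefinite, consistent under the partial trace, and supported on symmetric vectors. -/
structure IsBoseFamily (ρ : MatrixFamily D) : Prop where
  posSemidef : ∀ k, (Matrix.of (ρ k)).PosSemidef
  marginal : ∀ k x y, ∑ a, ρ (k + 1) (snocConfig x a) (snocConfig y a) = ρ k x y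
  symm : ∀ k (σ : Equiv.Perm (Fin k)) x y, ρ k (x ∘ σ) y = ρ k x y

/-- The common trace of the matrices of a compatible family. -/
def mass (ρ : MatrixFamily D) : ℂ := ρ 0 default default

/-- The family obtained by testing the first site against the vector `u`. -/
def slice (u : Fin (D + 1) → ℂ) (ρ : MatrixFamily D) : MatrixFamily D := fun k x y =>
  ∑ a, ∑ b, star (u a) * ρ (k + 1) (consConfig a x) (consConfig b y) * u b

namespace IsBoseFamily

variable {ρ : MatrixFamily D} (hρ : IsBoseFamily ρ)
include hρ

theorem star_apply (k : ℕ) (x y : Config D (Fin k)) : star (ρ k x y) = ρ k y x :=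
  (hρ.posSemidef k).isHermitian.apply y x

theorem symm_right (k : ℕ) (σ : Equiv.Perm (Fin k)) (x y : Config D (Fin k)) :
    ρ k x (y ∘ σ) = ρ k x y := by
  rw [← hρ.star_apply, hρ.symm, hρ.star_apply]

/-- A cyclic rotation, applied to rows and columns, moves the last site to the front. -/
theorem marginal_cons (k : ℕ) (x y : Config D (Fin k)) :
    ∑ a, ρ (k + 1) (consConfig a x) (consConfig a y) = ρ k x y := by
  rw [← hρ.marginal]
  refine Finset.sum_congr rfl fun a _ => ?_
  rw [snocConfig, snocConfig, Fin.snoc_eq_cons_rotate, Fin.snoc_eq_cons_rotate]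
  exact ((hρ.symm _ (finRotate (k + 1)) _ _).trans (hρ.symm_right _ (finRotate (k + 1)) _ _)).symm

theorem trace_eq (k : ℕ) : (Matrix.of (ρ k)).trace = mass ρ := by
  induction k with
  | zero =>
    rw [Matrix.trace, Fintype.sum_unique]
    exact congrArg₂ (ρ 0) (Subsingleton.elim _ _) (Subsingleton.elim _ _)
  | succ k ih =>
    rw [← ih, Matrix.trace, Matrix.trace, sum_snocConfig, Finset.sum_comm]
    exact Finset.sum_congr rfl fun x _ => hρ.marginal k x x

theorem norm_apply_le (k : ℕ) (x y : Config D (Fin k)) : ‖ρ k x y‖ ≤ (mass ρ).re := by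
  rw [← hρ.trace_eq k]
  exact (hρ.posSemidef k).norm_apply_le_trace x y

theorem mass_nonneg : 0 ≤ mass ρ := (hρ.posSemidef 0).diag_nonneg

theorem mass_re_nonneg : 0 ≤ (mass ρ).re := (Complex.le_def.1 hρ.mass_nonneg).1

theorem ofReal_mass_re : ((mass ρ).re : ℂ) = mass ρ :=
  Complex.ext rfl (Complex.le_def.1 hρ.mass_nonneg).2

theorem eq_zero_of_mass (h : mass ρ = 0) : ρ = 0 := by
  funext k x y
  simpa [h] using hρ.norm_apply_le k x y

end IsBoseFamily

/-- The first-site matrix obtained by testing the remaining sites against the vector `f`. -/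
def headMatrix (ρ : MatrixFamily D) {k : ℕ} (f : Config D (Fin k) → ℂ) :
    Matrix (Fin (D + 1)) (Fin (D + 1)) ℂ :=
  Matrix.of fun a b => ∑ x, ∑ y, star (f x) * ρ (k + 1) (consConfig a x) (consConfig b y) * f y

/-- Both sides are the quadratic form of the `(k + 1)`-site matrix at `u ⊗ f`; positivity of
`headMatrix` follows. -/
theorem dotProduct_headMatrix (ρ : MatrixFamily D) {k : ℕ} (f : Config D (Fin k) → ℂ)
    (u : Fin (D + 1) → ℂ) :
    star u ⬝ᵥ headMatrix ρ f *ᵥ u = star (fun z : Config D (Fin (k + 1)) => u (z 0) * f (Fin.tail z))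
      ⬝ᵥ Matrix.of (ρ (k + 1)) *ᵥ fun z => u (z 0) * f (Fin.tail z) := by
  simp only [dotProduct, Matrix.mulVec, sum_consConfig, headMatrix, Matrix.of_apply, Pi.star_apply,
    Fin.cons_zero, Fin.tail_cons, Finset.mul_sum, Finset.sum_mul, star_mul']
  refine Finset.sum_congr rfl fun a _ => ?_
  rw [Finset.sum_comm]
  refine Finset.sum_congr rfl fun x _ => Finset.sum_congr rfl fun b _ =>
    Finset.sum_congr rfl fun y _ => ?_
  ring

/-- The form at `u ⊗ f` may be evaluated in either order. This turns claims about slices, which are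
large matrices, into claims about the one-site matrix `headMatrix ρ f`. -/
theorem dotProduct_slice (ρ : MatrixFamily D) {k : ℕ} (f : Config D (Fin k) → ℂ)
    (u : Fin (D + 1) → ℂ) :
    star f ⬝ᵥ Matrix.of (slice u ρ k) *ᵥ f = star u ⬝ᵥ headMatrix ρ f *ᵥ u := by
  simp only [dotProduct, Matrix.mulVec, slice, headMatrix, Matrix.of_apply, Pi.star_apply,
    Finset.mul_sum, Finset.sum_mul]
  have h1 : ∀ F : Config D (Fin k) → Config D (Fin k) → Fin (D + 1) → Fin (D + 1) → ℂ,
      ∑ x, ∑ y, ∑ a, ∑ b, F x y a b = ∑ a, ∑ b, ∑ x, ∑ y, F x y a b := fun F => by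
    calc ∑ x, ∑ y, ∑ a, ∑ b, F x y a b = ∑ x, ∑ a, ∑ y, ∑ b, F x y a b :=
          Finset.sum_congr rfl fun x _ => Finset.sum_comm
      _ = ∑ a, ∑ x, ∑ y, ∑ b, F x y a b := Finset.sum_comm
      _ = ∑ a, ∑ x, ∑ b, ∑ y, F x y a b :=
          Finset.sum_congr rfl fun a _ => Finset.sum_congr rfl fun x _ => Finset.sum_comm
      _ = _ := Finset.sum_congr rfl fun a _ => Finset.sum_comm
  rw [h1]
  refine Finset.sum_congr rfl fun a _ => Finset.sum_congr rfl fun b _ =>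
    Finset.sum_congr rfl fun x _ => Finset.sum_congr rfl fun y _ => ?_
  ring

namespace IsBoseFamily

theorem add {ρ ρ' : MatrixFamily D} (hρ : IsBoseFamily ρ) (hρ' : IsBoseFamily ρ') :
    IsBoseFamily (ρ + ρ') where
  posSemidef k := (hρ.posSemidef k).add (hρ'.posSemidef k)
  marginal k x y := by
    simp only [Pi.add_apply, Finset.sum_add_distrib, hρ.marginal, hρ'.marginal]
  symm k σ x y := by simp only [Pi.add_apply, hρ.symm, hρ'.symm]

theorem smul {ρ : MatrixFamily D} (hρ : IsBoseFamily ρ) {t : ℝ} (ht : 0 ≤ t) :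
    IsBoseFamily (t • ρ) where
  posSemidef k := by
    have := (hρ.posSemidef k).smul (show (0 : ℂ) ≤ (t : ℂ) from Complex.zero_le_real.2 ht)
    convert this using 1
    ext x y
    exact Complex.real_smul
  marginal k x y := by
    simp only [Pi.smul_apply, ← Finset.smul_sum, hρ.marginal]
  symm k σ x y := by simp only [Pi.smul_apply, hρ.symm]

variable {ρ : MatrixFamily D} (hρ : IsBoseFamily ρ)
include hρ

theorem headMatrix_posSemidef {k : ℕ} (f : Config D (Fin k) → ℂ) :
    (headMatrix ρ f).PosSemidef := by
  refine Matrix.PosSemidef.of_dotProduct_mulVec_nonneg ?_ fun u => ?_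
  · ext a b
    simp only [headMatrix, Matrix.conjTranspose_apply, Matrix.of_apply, star_sum, star_mul',
      star_star, hρ.star_apply]
    rw [Finset.sum_comm]
    exact Finset.sum_congr rfl fun x _ => Finset.sum_congr rfl fun y _ => by ring
  · rw [dotProduct_headMatrix]
    exact (hρ.posSemidef _).dotProduct_mulVec_nonneg _

theorem headMatrix_trace {k : ℕ} (f : Config D (Fin k) → ℂ) :
    (headMatrix ρ f).trace = star f ⬝ᵥ Matrix.of (ρ k) *ᵥ f := by
  simp only [Matrix.trace, Matrix.diag_apply, headMatrix, Matrix.of_apply, dotProduct,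
    Matrix.mulVec, Finset.mul_sum, Pi.star_apply]
  rw [Finset.sum_comm]
  refine Finset.sum_congr rfl fun x _ => ?_
  rw [Finset.sum_comm]
  refine Finset.sum_congr rfl fun y _ => ?_
  rw [← hρ.marginal_cons, Finset.sum_mul, Finset.mul_sum]
  exact Finset.sum_congr rfl fun a _ => by ring

theorem slice_isHermitian (u : Fin (D + 1) → ℂ) (k : ℕ) :
    (Matrix.of (slice u ρ k)).IsHermitian := by
  ext x y
  simp only [slice, Matrix.conjTranspose_apply, Matrix.of_apply, star_sum, star_mul',
    star_star, hρ.star_apply]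
  rw [Finset.sum_comm]
  exact Finset.sum_congr rfl fun x _ => Finset.sum_congr rfl fun y _ => by ring

theorem slice_marginal (u : Fin (D + 1) → ℂ) (k : ℕ) (x y : Config D (Fin k)) :
    ∑ a, slice u ρ (k + 1) (snocConfig x a) (snocConfig y a) = slice u ρ k x y := by
  simp only [slice]
  rw [Finset.sum_comm]
  refine Finset.sum_congr rfl fun a _ => ?_
  rw [Finset.sum_comm]
  refine Finset.sum_congr rfl fun b _ => ?_
  rw [← hρ.marginal, Finset.mul_sum, Finset.sum_mul]
  simp only [consConfig, snocConfig, Fin.cons_snoc_eq_snoc_cons]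

theorem slice_symm (u : Fin (D + 1) → ℂ) (k : ℕ) (σ : Equiv.Perm (Fin k)) (x y : Config D (Fin k)) :
    slice u ρ k (x ∘ σ) y = slice u ρ k x y := by
  simp only [slice]
  refine Finset.sum_congr rfl fun a _ => Finset.sum_congr rfl fun b _ => ?_
  -- This permutation fixes the first site and acts as `σ` on the remaining ones.
  rw [← hρ.symm (k + 1) (Equiv.Perm.decomposeFin.symm (0, σ)) (consConfig a x)]
  congr 3
  funext j
  refine Fin.cases ?_ (fun i => ?_) j
  · simp
  · simp

theorem slice (u : Fin (D + 1) → ℂ) : IsBoseFamily (slice u ρ) where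
  posSemidef k := Matrix.PosSemidef.of_dotProduct_mulVec_nonneg (hρ.slice_isHermitian u k) fun f => by
    rw [dotProduct_slice]
    exact (hρ.headMatrix_posSemidef f).dotProduct_mulVec_nonneg u
  marginal := hρ.slice_marginal u
  symm := hρ.slice_symm u

/-- With `H = headMatrix ρ f`, the forms of `ρ k` and of the slice at `f` are `Tr H` and `u† H u`,
and the `ℓ¹` bound on `u` makes the latter the smaller. -/
theorem sub_slice (u : Fin (D + 1) → ℂ) (hu : ∑ a, ‖u a‖ ≤ 1) :
    IsBoseFamily (ρ - PermSymm.slice u ρ) where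
  posSemidef k := by
    have hH : (Matrix.of ((ρ - PermSymm.slice u ρ) k)).IsHermitian :=
      (hρ.posSemidef k).isHermitian.sub (hρ.slice_isHermitian u k)
    refine Matrix.PosSemidef.of_dotProduct_mulVec_nonneg hH fun f => ?_
    have hsub : Matrix.of ((ρ - PermSymm.slice u ρ) k) =
      Matrix.of (ρ k) - Matrix.of (PermSymm.slice u ρ k) := rfl
    rw [hsub, Matrix.sub_mulVec, dotProduct_sub, dotProduct_slice, sub_nonneg, Complex.le_def]
    have hP := hρ.headMatrix_posSemidef f
    have h1 := hP.dotProduct_mulVec_re_le_trace u hu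
    have h2 := Complex.le_def.1 (hP.dotProduct_mulVec_nonneg u)
    have h3 := Complex.le_def.1 hP.trace_nonneg
    rw [hρ.headMatrix_trace] at h1 h3
    exact ⟨h1, h2.2.symm.trans h3.2⟩
  marginal k x y := by
    simp only [Pi.sub_apply, Finset.sum_sub_distrib, hρ.marginal, hρ.slice_marginal]
  symm k σ x y := by simp only [Pi.sub_apply, hρ.symm, hρ.slice_symm]

end IsBoseFamily

end PermSymm

/-! ### Extreme states are product states. -/

namespace PermSymm

open scoped ComplexOrder

variable {D : ℕ}

variable (D) in
/-- The compatible families of density matrices: the states of infinitely many bosonic sites. -/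
def boseStates : Set (MatrixFamily D) := {ρ | IsBoseFamily ρ ∧ mass ρ = 1}

/-- The family of density matrices of the product vectors of `v`. -/
def productFamily (v : Fin (D + 1) → ℂ) : MatrixFamily D := fun _ x y =>
  ∏ j, v (x j) * star (v (y j))

theorem consConfig_zero (a : Fin (D + 1)) (x : Config D (Fin 0)) :
    consConfig a x = fun _ => a := by
  funext j
  fin_cases j
  rfl

theorem mass_smul (t : ℝ) (ρ : MatrixFamily D) : mass (t • ρ) = t * mass ρ := Complex.real_smul

theorem smul_mem_boseStates {ρ : MatrixFamily D} (hρ : IsBoseFamily ρ) (h : (mass ρ).re ≠ 0) :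
    (mass ρ).re⁻¹ • ρ ∈ boseStates D := by
  refine ⟨hρ.smul (inv_nonneg.2 hρ.mass_re_nonneg), ?_⟩
  rw [mass_smul]
  nth_rw 2 [← hρ.ofReal_mass_re]
  rw [← Complex.ofReal_mul, inv_mul_cancel₀ h, Complex.ofReal_one]

/-- An extreme state is proportional to each of its components. -/
theorem eq_mass_smul_of_mem_extremePoints {ρ α : MatrixFamily D}
    (hρ : ρ ∈ (boseStates D).extremePoints ℝ) (hα : IsBoseFamily α) (hβ : IsBoseFamily (ρ - α)) :
    α = (mass α).re • ρ := by
  obtain ⟨hmem, hext⟩ := mem_extremePoints.1 hρ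
  have hsum : (mass α).re + (mass (ρ - α)).re = 1 := by
    have : mass ρ = mass α + mass (ρ - α) := by simp [mass]
    rw [← Complex.add_re, ← this, hmem.2, Complex.one_re]
  by_cases h0 : (mass α).re = 0
  · rw [h0, zero_smul]
    exact hα.eq_zero_of_mass (by rw [← hα.ofReal_mass_re, h0, Complex.ofReal_zero])
  by_cases h1 : (mass (ρ - α)).re = 0
  · have := hβ.eq_zero_of_mass (by rw [← hβ.ofReal_mass_re, h1, Complex.ofReal_zero])
    rw [h1, add_zero] at hsum
    rw [hsum, one_smul]
    exact (sub_eq_zero.1 this).symm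
  -- `ρ` is a convex combination of the normalised `α` and `ρ - α`, with their masses as weights;
  -- extremality forces the former to be `ρ`.
  have := (hext _ (smul_mem_boseStates hα h0) _ (smul_mem_boseStates hβ h1)
    ⟨(mass α).re, (mass (ρ - α)).re, lt_of_le_of_ne hα.mass_re_nonneg (Ne.symm h0),
      lt_of_le_of_ne hβ.mass_re_nonneg (Ne.symm h1), hsum, by
        rw [smul_inv_smul₀ h0, smul_inv_smul₀ h1, add_sub_cancel]⟩).1
  exact (inv_smul_eq_iff₀ h0).1 this

theorem slice_smul (c : ℝ) (u : Fin (D + 1) → ℂ) (ρ : MatrixFamily D) :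
    slice (c • u) ρ = (c ^ 2) • slice u ρ := by
  funext k x y
  simp only [slice, Pi.smul_apply, Finset.smul_sum, Complex.real_smul, star_mul']
  refine Finset.sum_congr rfl fun a _ => Finset.sum_congr rfl fun b _ => ?_
  have : star (c : ℂ) = c := Complex.conj_ofReal c
  rw [this]
  push_cast
  ring

/-- Once `u` is scaled into the `ℓ¹` unit ball, its slice is a component of `ρ`. Slices are
quadratic in `u`, so the scaling cancels from both sides. -/
theorem slice_eq_of_mem_extremePoints {ρ : MatrixFamily D}
    (hρ : ρ ∈ (boseStates D).extremePoints ℝ) (u : Fin (D + 1) → ℂ) :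
    slice u ρ = (mass (slice u ρ)).re • ρ := by
  set S := ∑ a, ‖u a‖ with hS
  have hS0 : 0 ≤ S := Finset.sum_nonneg fun a _ => norm_nonneg _
  -- `S + 1` rather than `S`, so that `u = 0` needs no separate treatment.
  have hc : (0 : ℝ) < (S + 1)⁻¹ := by positivity
  have hu : ∑ a, ‖((S + 1)⁻¹ • u) a‖ ≤ 1 := by
    simp only [Pi.smul_apply, norm_smul, ← Finset.mul_sum, ← hS]
    rw [Real.norm_of_nonneg hc.le, inv_mul_le_one₀ (by positivity)]
    linarith
  have h := eq_mass_smul_of_mem_extremePoints hρ (hρ.1.1.slice _) (hρ.1.1.sub_slice _ hu)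
  rw [slice_smul, mass_smul, Complex.re_ofReal_mul, mul_smul] at h
  exact smul_right_injective _ (pow_ne_zero 2 hc.ne') h

/-- In an extreme state the first site is uncorrelated with the others. -/
theorem apply_consConfig_of_mem_extremePoints {ρ : MatrixFamily D}
    (hρ : ρ ∈ (boseStates D).extremePoints ℝ) (k : ℕ) (a b : Fin (D + 1))
    (x y : Config D (Fin k)) :
    ρ (k + 1) (consConfig a x) (consConfig b y) = ρ 1 (fun _ => a) (fun _ => b) * ρ k x y := by
  -- The slice identity equates the two sides only as quadratic forms in `u`; over `ℂ` a form
  -- determines its matrix.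
  have hz : Matrix.of (fun a b => ρ (k + 1) (consConfig a x) (consConfig b y) -
      ρ 1 (fun _ => a) (fun _ => b) * ρ k x y) = 0 := by
    refine Matrix.eq_zero_of_dotProduct_mulVec_eq_zero fun u => ?_
    have h := congrFun (congrFun (congrFun (slice_eq_of_mem_extremePoints hρ u) k) x) y
    rw [Pi.smul_apply, Pi.smul_apply, Pi.smul_apply, Complex.real_smul,
      (hρ.1.1.slice u).ofReal_mass_re] at h
    have hm : mass (slice u ρ) = ∑ a, ∑ b, star (u a) * ρ 1 (fun _ => a) (fun _ => b) * u b := by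
      simp only [mass, slice]
      refine Finset.sum_congr rfl fun a _ => Finset.sum_congr rfl fun b _ => ?_
      rw [consConfig_zero, consConfig_zero]
    rw [hm, slice, ← sub_eq_zero] at h
    rw [← h]
    simp only [dotProduct, Matrix.mulVec, Matrix.of_apply, Pi.star_apply, Finset.mul_sum,
      Finset.sum_mul, ← Finset.sum_sub_distrib]
    refine Finset.sum_congr rfl fun a _ => Finset.sum_congr rfl fun b _ => ?_
    ring
  exact sub_eq_zero.1 (congrFun (congrFun hz a) b)

theorem apply_eq_prod_of_mem_extremePoints {ρ : MatrixFamily D}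
    (hρ : ρ ∈ (boseStates D).extremePoints ℝ) (k : ℕ) (x y : Config D (Fin k)) :
    ρ k x y = ∏ j, ρ 1 (fun _ => x j) (fun _ => y j) := by
  induction k with
  | zero =>
    rw [Fintype.prod_empty, ← hρ.1.2]
    exact congrArg₂ (ρ 0) (Subsingleton.elim _ _) (Subsingleton.elim _ _)
  | succ k ih =>
    rw [← Fin.cons_self_tail x, ← Fin.cons_self_tail y, Fin.prod_univ_succ]
    simp only [Fin.cons_zero, Fin.cons_succ]
    rw [← ih, ← apply_consConfig_of_mem_extremePoints hρ]

/-- The one-site marginal of an extreme state has rank one. -/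
theorem one_site_exchange_of_mem_extremePoints {ρ : MatrixFamily D}
    (hρ : ρ ∈ (boseStates D).extremePoints ℝ) (a b c d : Fin (D + 1)) :
    ρ 1 (fun _ => a) (fun _ => c) * ρ 1 (fun _ => b) (fun _ => d) =
      ρ 1 (fun _ => b) (fun _ => c) * ρ 1 (fun _ => a) (fun _ => d) := by
  -- Only the row configuration is swapped: this is Bose symmetry, stronger than invariance under
  -- simultaneous permutation of rows and columns.
  have h := hρ.1.1.symm 2 (Equiv.swap 0 1) ![b, a] ![c, d]
  rw [apply_eq_prod_of_mem_extremePoints hρ, apply_eq_prod_of_mem_extremePoints hρ,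
    Fin.prod_univ_two, Fin.prod_univ_two] at h
  simpa using h

/-- Extreme states are the states of product vectors. -/
theorem exists_eq_productFamily {ρ : MatrixFamily D} (hρ : ρ ∈ (boseStates D).extremePoints ℝ) :
    ∃ v : Fin (D + 1) → ℂ, ∑ a, ‖v a‖ ^ 2 = 1 ∧ ρ = productFamily v := by
  set r : Fin (D + 1) → Fin (D + 1) → ℂ := fun a b => ρ 1 (fun _ => a) (fun _ => b) with hr
  have hstar : ∀ a b, star (r a b) = r b a := fun a b => hρ.1.1.star_apply _ _ _
  have htr : ∑ a, r a a = 1 := by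
    rw [← hρ.1.2, mass, ← hρ.1.1.marginal_cons]
    exact Finset.sum_congr rfl fun a _ => by rw [consConfig_zero]
  have hnn : ∀ a, 0 ≤ r a a := fun a => (hρ.1.1.posSemidef 1).diag_nonneg
  obtain ⟨c, -, hc⟩ : ∃ c ∈ Finset.univ, r c c ≠ 0 :=
    Finset.exists_ne_zero_of_sum_ne_zero (by rw [htr]; exact one_ne_zero)
  set t : ℝ := (r c c).re with ht
  have htc : (t : ℂ) = r c c := Complex.ext rfl (Complex.le_def.1 (hnn c)).2
  have ht0 : 0 < t := lt_of_le_of_ne (Complex.le_def.1 (hnn c)).1 fun h => hc (by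
    rw [← htc, ← h, Complex.ofReal_zero])
  -- The vector is column `c` of the rank-one matrix `r`, divided by `√(r c c)`; the exchange
  -- relation `r a c * r c b = r c c * r a b` then recovers `r`.
  set q : ℝ := (√t)⁻¹ with hq
  have hsq : (q : ℂ) * q = (r c c)⁻¹ := by
    rw [← Complex.ofReal_mul, hq, ← mul_inv, Real.mul_self_sqrt ht0.le, Complex.ofReal_inv, htc]
  have hv : ∀ a b, (q * r a c : ℂ) * star (q * r b c : ℂ) = r a b := fun a b => by
    have hreal : star (q : ℂ) = q := Complex.conj_ofReal _
    rw [star_mul', hreal, hstar, mul_mul_mul_comm, hsq,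
      one_site_exchange_of_mem_extremePoints hρ a c c b, inv_mul_cancel_left₀ hc]
  refine ⟨fun a => q * r a c, ?_, ?_⟩
  · have : ∀ a, ((‖(q * r a c : ℂ)‖ ^ 2 : ℝ) : ℂ) = r a a := fun a => by
      rw [← hv a a, Complex.ofReal_pow]
      exact (Complex.mul_conj' _).symm
    have h := htr
    simp only [← this] at h
    exact_mod_cast h
  · funext k x y
    rw [apply_eq_prod_of_mem_extremePoints hρ, productFamily]
    exact Finset.prod_congr rfl fun j _ => (hv (x j) (y j)).symm

end PermSymm

/-! ### Compactness, Krein–Milman and the de Finetti decomposition. -/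

namespace PermSymm

open scoped ComplexOrder

variable {D : ℕ}

theorem convex_boseStates : Convex ℝ (boseStates D) := by
  intro ρ hρ ρ' hρ' a b ha hb hab
  refine ⟨(hρ.1.smul ha).add (hρ'.1.smul hb), ?_⟩
  have : mass (a • ρ + b • ρ') = mass (a • ρ) + mass (b • ρ') := rfl
  rw [this, mass_smul, mass_smul, hρ.2, hρ'.2, mul_one, mul_one, ← Complex.ofReal_add, hab,
    Complex.ofReal_one]

theorem continuous_matrixFamily_apply (k : ℕ) (x y : Config D (Fin k)) :
    Continuous fun ρ : MatrixFamily D => ρ k x y := by fun_prop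

theorem isClosed_boseStates : IsClosed (boseStates D) := by
  have hset : boseStates D =
      {ρ | ∀ k, (∀ x y, star (ρ k x y) = ρ k y x) ∧
        ∀ f : Config D (Fin k) → ℂ, 0 ≤ star f ⬝ᵥ Matrix.of (ρ k) *ᵥ f} ∩
      {ρ | ∀ k x y, ∑ a, ρ (k + 1) (snocConfig x a) (snocConfig y a) = ρ k x y} ∩
      {ρ | ∀ k (σ : Equiv.Perm (Fin k)) x y, ρ k (x ∘ σ) y = ρ k x y} ∩
      {ρ | mass ρ = 1} := by
    ext ρ
    constructor
    · rintro ⟨h, h1⟩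
      exact ⟨⟨⟨fun k => ⟨h.star_apply k, (h.posSemidef k).dotProduct_mulVec_nonneg⟩, h.marginal⟩,
        h.symm⟩, h1⟩
    · rintro ⟨⟨⟨h, hm⟩, hs⟩, h1⟩
      exact ⟨⟨fun k => Matrix.PosSemidef.of_dotProduct_mulVec_nonneg
        (by ext x y; exact (h k).1 y x) (h k).2, hm, hs⟩, h1⟩
  rw [hset]
  refine ((IsClosed.inter ?_ ?_).inter ?_).inter ?_
  · simp only [Set.ofPred_forall, Set.ofPred_and]
    refine isClosed_iInter fun k => IsClosed.inter ?_ ?_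
    · exact isClosed_iInter fun x => isClosed_iInter fun y => isClosed_eq (by fun_prop) (by fun_prop)
    · refine isClosed_iInter fun f => isClosed_le continuous_const ?_
      simp only [dotProduct, Matrix.mulVec, Matrix.of_apply]
      fun_prop
  · simp only [Set.ofPred_forall]
    exact isClosed_iInter fun k => isClosed_iInter fun x => isClosed_iInter fun y =>
      isClosed_eq (by fun_prop) (by fun_prop)
  · simp only [Set.ofPred_forall]
    exact isClosed_iInter fun k => isClosed_iInter fun σ => isClosed_iInter fun x =>
      isClosed_iInter fun y => isClosed_eq (by fun_prop) (by fun_prop)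
  · exact isClosed_eq (continuous_matrixFamily_apply 0 _ _) continuous_const

/-- Entries are bounded by the trace, which is 1, so the states form a closed subset of a product of
unit discs, compact by Tychonoff. -/
theorem isCompact_boseStates : IsCompact (boseStates D) := by
  have hK : IsCompact (Set.univ.pi fun k : ℕ => Set.univ.pi fun _ : Config D (Fin k) =>
      Set.univ.pi fun _ : Config D (Fin k) => Metric.closedBall (0 : ℂ) 1) :=
    isCompact_univ_pi fun _ => isCompact_univ_pi fun _ => isCompact_univ_pi fun _ =>
      isCompact_closedBall 0 1
  refine hK.of_isClosed_subset isClosed_boseStates fun ρ hρ k _ x _ y _ => ?_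
  rw [mem_closedBall_zero_iff]
  simpa [hρ.2] using hρ.1.norm_apply_le k x y

variable (D) in
/-- The unit sphere of the local space. -/
abbrev UnitSphere : Type := Metric.sphere (0 : EuclideanSpace ℂ (Fin (D + 1))) 1

theorem continuous_productFamily_sphere (k : ℕ) (x y : Config D (Fin k)) :
    Continuous fun s : UnitSphere D => productFamily s.1.ofLp k x y := by
  unfold productFamily
  fun_prop

/-- Mixtures of product states. -/
noncomputable def mixture (μ : ProbabilityMeasure (UnitSphere D)) : MatrixFamily D := fun k x y =>
  ∫ s, productFamily s.1.ofLp k x y ∂(μ : Measure (UnitSphere D))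

/-- Each entry is the integral of a continuous function on the compact sphere, hence weakly
continuous in the measure. -/
theorem continuous_mixture : Continuous (mixture (D := D)) := by
  refine continuous_pi fun k => continuous_pi fun x => continuous_pi fun y => ?_
  rw [continuous_iff_continuousAt]
  intro μ
  exact (ProbabilityMeasure.tendsto_iff_forall_integral_rclike_tendsto ℂ).1 tendsto_id
    (BoundedContinuousFunction.mkOfCompact ⟨_, continuous_productFamily_sphere k x y⟩)

theorem convex_range_mixture : Convex ℝ (Set.range (mixture (D := D))) := by
  rintro _ ⟨μ, rfl⟩ _ ⟨ν, rfl⟩ a b ha hb hab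
  have hprob : IsProbabilityMeasure
      (ENNReal.ofReal a • (μ : Measure (UnitSphere D)) + ENNReal.ofReal b • (ν : Measure _)) := by
    refine ⟨?_⟩
    simp [← ENNReal.ofReal_add ha hb, hab]
  refine ⟨⟨_, hprob⟩, ?_⟩
  funext k x y
  have hint : ∀ m : ProbabilityMeasure (UnitSphere D),
      Integrable (fun s : UnitSphere D => productFamily s.1.ofLp k x y) (m : Measure _) :=
    fun m => (BoundedContinuousFunction.mkOfCompact
      ⟨_, continuous_productFamily_sphere k x y⟩).integrable _
  simp only [mixture, ProbabilityMeasure.coe_mk, Pi.add_apply, Pi.smul_apply]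
  rw [integral_add_measure ((hint μ).smul_measure ENNReal.ofReal_ne_top)
    ((hint ν).smul_measure ENNReal.ofReal_ne_top), integral_smul_measure, integral_smul_measure,
    ENNReal.toReal_ofReal ha, ENNReal.toReal_ofReal hb]

/-- Quantum de Finetti theorem for bosonic states: they are mixtures of product states. -/
theorem exists_mixture_eq {ρ : MatrixFamily D} (hρ : ρ ∈ boseStates D) :
    ∃ μ : ProbabilityMeasure (UnitSphere D), mixture μ = ρ := by
  have hclosed : IsClosed (Set.range (mixture (D := D))) :=
    (isCompact_range continuous_mixture).isClosed
  have hsub : (boseStates D).extremePoints ℝ ⊆ Set.range (mixture (D := D)) := by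
    intro ρ hρ
    obtain ⟨v, hv, rfl⟩ := exists_eq_productFamily hρ
    have hs : WithLp.toLp 2 v ∈ Metric.sphere (0 : EuclideanSpace ℂ (Fin (D + 1))) 1 := by
      rw [mem_sphere_zero_iff_norm, EuclideanSpace.norm_eq]
      simp [hv]
    refine ⟨⟨Measure.dirac ⟨_, hs⟩, inferInstance⟩, ?_⟩
    funext k x y
    simp [mixture]
  have hmem := closure_minimal (convexHull_min hsub convex_range_mixture) hclosed
  rw [closure_convexHull_extremePoints isCompact_boseStates convex_boseStates] at hmem
  exact hmem hρ

end PermSymm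

/-! ### Reduced matrices of finite symmetric vectors. -/

namespace PermSymm

open scoped ComplexOrder

variable {D : ℕ}

/-- The configuration on `N` sites which is `x` on the sites labelled by `Fin k` and `c` on the
others, for a labelling `w` of the sites. -/
abbrev joinConfig {k N : ℕ} {S : Type} (w : Fin k ⊕ S ≃ Fin N) (x : Config D (Fin k))
    (c : Config D S) : Config D (Fin N) := Sum.elim x c ∘ w.symm

theorem sum_joinConfig {M : Type*} [AddCommMonoid M] {k N : ℕ} {S : Type} [Fintype S]
    [DecidableEq S] (w : Fin k ⊕ S ≃ Fin N) (f : Config D (Fin N) → M) :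
    ∑ X, f X = ∑ x, ∑ c : Config D S, f (joinConfig w x c) := by
  rw [← Fintype.sum_prod_type']
  refine (Equiv.sum_comp ((Equiv.sumArrowEquivProdArrow (Fin k) S (Fin (D + 1))).symm.trans
    (Equiv.arrowCongr w (Equiv.refl _))) f).symm.trans (Finset.sum_congr rfl fun p _ => ?_)
  rfl

/-- The matrix of `|φ⟩⟨φ|/⟨φ|φ⟩` after the partial trace over the sites labelled by `S`. -/
noncomputable def marginalMatrix {k N : ℕ} {S : Type} [Fintype S] [DecidableEq S]
    (w : Fin k ⊕ S ≃ Fin N) (φ : Hilb D N) (x y : Config D (Fin k)) : ℂ :=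
  ∑ c : Config D S, (star φ ⬝ᵥ φ)⁻¹ * (φ (joinConfig w x c) * star (φ (joinConfig w y c)))

/-- For a symmetric vector the reduced matrix depends only on the number of sites. -/
theorem marginalMatrix_eq {k N : ℕ} {S S' : Type} [Fintype S] [DecidableEq S] [Fintype S']
    [DecidableEq S'] (w : Fin k ⊕ S ≃ Fin N) (w' : Fin k ⊕ S' ≃ Fin N) {φ : Hilb D N}
    (hφ : IsSymmetric φ) (x y : Config D (Fin k)) :
    marginalMatrix w φ x y = marginalMatrix w' φ x y := by
  have hcard : Fintype.card S = Fintype.card S' := by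
    have h := Fintype.card_congr (w.trans w'.symm)
    simpa using h
  let e : S ≃ S' := Fintype.equivOfCardEq hcard
  have hjoin : ∀ (z : Config D (Fin k)) (c : Config D S'),
      φ (joinConfig w z (c ∘ e)) = φ (joinConfig w' z c) := fun z c => by
    -- Once the traced-out sites are matched by `e`, the two labellings differ by this permutation
    -- of the sites, under which `φ` is invariant.
    rw [← hφ (w.symm.trans ((Equiv.sumCongr (Equiv.refl _) e).trans w')) (joinConfig w' z c)]
    congr 1
    funext j
    simp only [Function.comp_apply, Equiv.trans_apply, Equiv.symm_apply_apply]
    cases w.symm j <;> rfl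
  refine ((Equiv.arrowCongr e (Equiv.refl (Fin (D + 1)))).symm.sum_comp _).symm.trans
    (Finset.sum_congr rfl fun c _ => ?_)
  have hc : (Equiv.arrowCongr e (Equiv.refl (Fin (D + 1)))).symm c = c ∘ e := rfl
  rw [hc, hjoin, hjoin]

/-- The labelling of the sites by the first `k` and the last `N - k`. -/
def initialLabelling {k N : ℕ} (h : k ≤ N) : Fin k ⊕ Fin (N - k) ≃ Fin N :=
  finSumFinEquiv.trans (finCongr (Nat.add_sub_cancel' h))

theorem joinConfig_initialLabelling_comp_castLE {k N : ℕ} (h : k ≤ N) (x : Config D (Fin k))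
    (c : Config D (Fin (N - k))) : joinConfig (initialLabelling h) x c ∘ Fin.castLE h = x := by
  funext j
  have : initialLabelling h (Sum.inl j) = Fin.castLE h j := by
    ext
    simp [initialLabelling]
  simp [← this]

theorem joinConfig_initialLabelling_tail {k N : ℕ} (h : k ≤ N) (x y : Config D (Fin k))
    (c c' : Config D (Fin (N - k))) :
    (∀ j : Fin N, k ≤ (j : ℕ) → joinConfig (initialLabelling h) x c j =
      joinConfig (initialLabelling h) y c' j) ↔ c = c' := by
  constructor
  · intro H
    funext i
    have := H (initialLabelling h (Sum.inr i)) (by simp [initialLabelling])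
    simpa using this
  · rintro rfl j hj
    obtain ⟨s, rfl⟩ := (initialLabelling h).surjective j
    cases s with
    | inl i =>
      have : ((initialLabelling h (Sum.inl i) : Fin N) : ℕ) = i := by simp [initialLabelling]
      omega
    | inr i => simp

/-- The identity on the last sites forces equal configurations there, leaving the trace of `O`
against the reduced matrix. -/
theorem pureState_embedOp {k N : ℕ} (h : k ≤ N) (φ : Hilb D N) (O : Op D k) :
    pureState φ (embedOp h O) =
      ∑ x, ∑ y, O y x * marginalMatrix (initialLabelling h) φ x y := by
  have hform : star φ ⬝ᵥ embedOp h O *ᵥ φ = ∑ x, ∑ y, O y x * ∑ c,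
      φ (joinConfig (initialLabelling h) x c) * star (φ (joinConfig (initialLabelling h) y c)) := by
    have hentry : ∀ x y c c', embedOp h O (joinConfig (initialLabelling h) y c)
        (joinConfig (initialLabelling h) x c') = if c = c' then O y x else 0 := fun x y c c' => by
      simp only [embedOp, Matrix.of_apply, joinConfig_initialLabelling_tail,
        joinConfig_initialLabelling_comp_castLE]
    simp only [dotProduct, Matrix.mulVec, sum_joinConfig (initialLabelling h), hentry,
      ite_mul, zero_mul, Finset.sum_ite_eq, Finset.mem_univ, if_true, Pi.star_apply]
    simp only [Finset.mul_sum]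
    calc _ = ∑ y, ∑ x, ∑ c, star (φ (joinConfig (initialLabelling h) y c)) *
          (O y x * φ (joinConfig (initialLabelling h) x c)) :=
        Finset.sum_congr rfl fun y _ => Finset.sum_comm
      _ = _ := by
        rw [Finset.sum_comm]
        exact Finset.sum_congr rfl fun x _ => Finset.sum_congr rfl fun y _ =>
          Finset.sum_congr rfl fun c _ => by ring
  change star φ ⬝ᵥ embedOp h O *ᵥ φ / (star φ ⬝ᵥ φ) = _
  rw [hform, div_eq_mul_inv, Finset.sum_mul]
  refine Finset.sum_congr rfl fun x _ => ?_
  rw [Finset.sum_mul]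
  refine Finset.sum_congr rfl fun y _ => ?_
  rw [marginalMatrix, ← Finset.mul_sum]
  ring

theorem pureState_embedOp_single {k N : ℕ} (h : k ≤ N) (φ : Hilb D N) (x y : Config D (Fin k)) :
    pureState φ (embedOp h (Matrix.single y x 1)) =
      marginalMatrix (initialLabelling h) φ x y := by
  rw [pureState_embedOp, Finset.sum_eq_single x, Finset.sum_eq_single y]
  · simp
  · intro b _ hb
    simp [hb.symm]
  · simp
  · intro b _ hb
    simp [hb.symm]
  · simp

theorem reducedDensity_eq_marginalMatrix {k N : ℕ} {A : Finset (Fin N)}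
    (e : Fin k ≃ {j // j ∈ A}) (φ : Hilb D N) (x y : Config D (Fin k)) :
    reducedDensity A φ (x ∘ e.symm) (y ∘ e.symm) =
      marginalMatrix ((Equiv.sumCongr e (Equiv.refl _)).trans (Equiv.sumCompl (· ∈ A))) φ x y := by
  have hglue : ∀ (z : Config D (Fin k)) (c : Config D {j // j ∉ A}),
      glue A (z ∘ e.symm) c =
        joinConfig ((Equiv.sumCongr e (Equiv.refl _)).trans (Equiv.sumCompl (· ∈ A))) z c :=
    fun z c => by
      funext j
      by_cases hj : j ∈ A
      · simp [glue, hj, Equiv.sumCompl_symm_apply_of_pos]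
      · simp [glue, hj, Equiv.sumCompl_symm_apply_of_neg]
  simp only [reducedDensity, Matrix.of_apply, density, hglue, Matrix.smul_apply,
    Matrix.vecMulVec_apply, smul_eq_mul, Pi.star_apply, marginalMatrix]

section marginalMatrix

variable {k N : ℕ} {S : Type} [Fintype S] [DecidableEq S] (w : Fin k ⊕ S ≃ Fin N) (φ : Hilb D N)

theorem marginalMatrix_posSemidef : (Matrix.of (marginalMatrix w φ)).PosSemidef := by
  have h0 : 0 ≤ (star φ ⬝ᵥ φ)⁻¹ := inv_nonneg.2 (dotProduct_star_self_nonneg φ)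
  have h : Matrix.of (marginalMatrix w φ) = ∑ c : Config D S, (star φ ⬝ᵥ φ)⁻¹ •
      Matrix.vecMulVec (fun x => φ (joinConfig w x c)) (star fun x => φ (joinConfig w x c)) := by
    ext x y
    rw [Matrix.sum_apply]
    rfl
  rw [h]
  exact Matrix.posSemidef_sum _ fun c _ =>
    (Matrix.posSemidef_vecMulVec_self_star _).smul h0

variable {φ}

theorem marginalMatrix_trace (hφ : φ ≠ 0) : ∑ x, marginalMatrix w φ x x = 1 := by
  simp only [marginalMatrix, ← Finset.mul_sum]
  rw [← sum_joinConfig w fun X => φ X * star (φ X)]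
  have : star φ ⬝ᵥ φ = ∑ X, φ X * star (φ X) := Finset.sum_congr rfl fun X _ => mul_comm _ _
  rw [← this, inv_mul_cancel₀]
  exact mt dotProduct_star_self_eq_zero.1 hφ

theorem marginalMatrix_symm (hφ : IsSymmetric φ) (σ : Equiv.Perm (Fin k))
    (x y : Config D (Fin k)) : marginalMatrix w φ (x ∘ σ) y = marginalMatrix w φ x y := by
  refine Finset.sum_congr rfl fun c _ => ?_
  have h : φ (joinConfig w (x ∘ σ) c) = φ (joinConfig w x c) := by
    rw [← hφ (w.symm.trans ((Equiv.sumCongr σ (Equiv.refl _)).trans w)) (joinConfig w x c)]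
    congr 1
    funext j
    simp only [Function.comp_apply, Equiv.trans_apply, Equiv.symm_apply_apply]
    cases w.symm j <;> rfl
  rw [h]

end marginalMatrix

/-- The labelling which moves the last distinguished site to the traced-out sites. -/
def shiftLabelling {k N : ℕ} {S : Type} (w : Fin (k + 1) ⊕ S ≃ Fin N) :
    Fin k ⊕ (Fin 1 ⊕ S) ≃ Fin N :=
  (Equiv.sumAssoc _ _ _).symm.trans ((Equiv.sumCongr finSumFinEquiv (Equiv.refl S)).trans w)

theorem joinConfig_shiftLabelling {k N : ℕ} {S : Type} (w : Fin (k + 1) ⊕ S ≃ Fin N)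
    (x : Config D (Fin k)) (a : Fin (D + 1)) (c : Config D S) :
    joinConfig (shiftLabelling w) x (Sum.elim (fun _ => a) c) =
      joinConfig w (snocConfig x a) c := by
  funext j
  obtain ⟨s, rfl⟩ := (shiftLabelling w).surjective j
  rcases s with i | i | i
  · have : shiftLabelling w (Sum.inl i) = w (Sum.inl i.castSucc) := rfl
    simp only [Function.comp_apply, Equiv.symm_apply_apply]
    rw [this, Equiv.symm_apply_apply]
    simp
  · have : shiftLabelling w (Sum.inr (Sum.inl i)) = w (Sum.inl (Fin.last k)) := by
      rw [Subsingleton.elim i 0]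
      rfl
    simp only [Function.comp_apply, Equiv.symm_apply_apply]
    rw [this, Equiv.symm_apply_apply]
    simp
  · have : shiftLabelling w (Sum.inr (Sum.inr i)) = w (Sum.inr i) := rfl
    simp only [Function.comp_apply, Equiv.symm_apply_apply]
    rw [this, Equiv.symm_apply_apply]
    simp

/-- Summing over the last retained site amounts to tracing it out together with `S`. With
`marginalMatrix_eq` this yields compatibility of the limit family. -/
theorem sum_marginalMatrix_snocConfig {k N : ℕ} {S : Type} [Fintype S] [DecidableEq S]
    (w : Fin (k + 1) ⊕ S ≃ Fin N) (φ : Hilb D N) (x y : Config D (Fin k)) :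
    ∑ a, marginalMatrix w φ (snocConfig x a) (snocConfig y a) =
      marginalMatrix (shiftLabelling w) φ x y := by
  simp only [marginalMatrix, ← joinConfig_shiftLabelling]
  rw [← Fintype.sum_prod_type']
  refine (Equiv.sum_comp ((Equiv.prodCongr (Equiv.funUnique (Fin 1) (Fin (D + 1)))
    (Equiv.refl (Config D S))).symm.trans
    (Equiv.sumArrowEquivProdArrow (Fin 1) S (Fin (D + 1))).symm) (fun c : Config D (Fin 1 ⊕ S) =>
      (star φ ⬝ᵥ φ)⁻¹ * (φ (joinConfig (shiftLabelling w) x c) *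
        star (φ (joinConfig (shiftLabelling w) y c)))))

end PermSymm

/-! ### Passage to the limit and the measure on projective space. -/

namespace PermSymm

open scoped ComplexOrder

variable {D : ℕ}

/-- The matrix entries of a functional on finitely-supported operators. -/
def limitFamily (ψ : LocalFunctional D) : MatrixFamily D := fun k x y => ψ k (Matrix.single y x 1)

theorem eq_sum_limitFamily (ψ : LocalFunctional D) (k : ℕ) (O : Op D k) :
    ψ k O = ∑ x, ∑ y, O y x * limitFamily ψ k x y := by
  conv_lhs => rw [Matrix.matrix_eq_sum_single O]
  simp only [map_sum]
  rw [Finset.sum_comm]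
  refine Finset.sum_congr rfl fun x _ => Finset.sum_congr rfl fun y _ => ?_
  rw [limitFamily, ← smul_eq_mul, ← map_smul, Matrix.smul_single, smul_eq_mul, mul_one]

theorem tendsto_marginalMatrix {Φ : ∀ N : ℕ, Hilb D N} {ψ : LocalFunctional D}
    (hψ : ConvergesLocally Φ ψ) (k : ℕ) (x y : Config D (Fin k)) :
    Tendsto (fun N => if h : k ≤ N then marginalMatrix (initialLabelling h) (Φ N) x y else 0)
      atTop (𝓝 (limitFamily ψ k x y)) := by
  simpa only [pureState_embedOp_single, limitFamily] using hψ k (Matrix.single y x 1)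

/-- A limit of the states of symmetric vectors is a state of infinitely many bosonic sites. -/
theorem limitFamily_mem_boseStates {Φ : ∀ N : ℕ, Hilb D N}
    (hsymm : ∀ N : ℕ, 1 ≤ N → IsSymmetric (Φ N)) (hne : ∀ N : ℕ, 1 ≤ N → Φ N ≠ 0)
    {ψ : LocalFunctional D} (hψ : ConvergesLocally Φ ψ) : limitFamily ψ ∈ boseStates D := by
  have hlim := tendsto_marginalMatrix hψ
  refine ⟨⟨fun k => Matrix.PosSemidef.of_dotProduct_mulVec_nonneg ?_ fun f => ?_,
    fun k x y => ?_, fun k σ x y => ?_⟩, ?_⟩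
  · ext x y
    refine tendsto_nhds_unique (hlim k y x).star ((hlim k x y).congr' ?_)
    filter_upwards [eventually_ge_atTop k] with N hN
    rw [dif_pos hN, dif_pos hN]
    exact ((marginalMatrix_posSemidef (initialLabelling hN) (Φ N)).isHermitian.apply x y).symm
  · refine ge_of_tendsto (x := atTop) (f := fun N => star f ⬝ᵥ Matrix.of (fun x y =>
      if h : k ≤ N then marginalMatrix (initialLabelling h) (Φ N) x y else 0) *ᵥ f) ?_ ?_
    · simp only [dotProduct, Matrix.mulVec, Matrix.of_apply]
      exact tendsto_finsetSum _ fun x _ => (tendsto_finsetSum _ fun y _ =>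
        (hlim k x y).mul_const _).const_mul _
    · filter_upwards [eventually_ge_atTop k] with N hN
      simp only [dif_pos hN]
      exact (marginalMatrix_posSemidef (initialLabelling hN) (Φ N)).dotProduct_mulVec_nonneg f
  · refine tendsto_nhds_unique (tendsto_finsetSum _ fun a _ => hlim (k + 1) (snocConfig x a)
      (snocConfig y a)) ((hlim k x y).congr' ?_)
    filter_upwards [eventually_ge_atTop (k + 1)] with N hN
    simp only [dif_pos hN, dif_pos ((Nat.le_succ k).trans hN)]
    rw [sum_marginalMatrix_snocConfig]
    exact marginalMatrix_eq _ _ (hsymm N ((Nat.le_add_left 1 k).trans hN)) x y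
  · refine tendsto_nhds_unique (hlim k (x ∘ σ) y) ((hlim k x y).congr' ?_)
    filter_upwards [eventually_ge_atTop k, eventually_ge_atTop 1] with N hN hN1
    rw [dif_pos hN, dif_pos hN, marginalMatrix_symm _ (hsymm N hN1)]
  · refine tendsto_nhds_unique (hlim 0 default default) (tendsto_const_nhds.congr' ?_)
    filter_upwards [eventually_ge_atTop 1] with N hN1
    rw [dif_pos (Nat.zero_le N), ← marginalMatrix_trace (initialLabelling (Nat.zero_le N))
      (hne N hN1), Fintype.sum_unique]
    exact congrArg₂ (marginalMatrix _ _) (Subsingleton.elim _ _) (Subsingleton.elim _ _)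

theorem star_productVec_dotProduct (v w : Fin (D + 1) → ℂ) (k : ℕ) :
    star (productVec v k) ⬝ᵥ productVec w k = (star v ⬝ᵥ w) ^ k := by
  simp only [dotProduct, productVec, Pi.star_apply, star_prod, ← Finset.prod_mul_distrib]
  rw [← Fin.prod_const, Finset.prod_univ_sum, Fintype.piFinset_univ]

theorem productVec_smul (c : ℂ) (v : Fin (D + 1) → ℂ) (k : ℕ) :
    productVec (c • v) k = c ^ k • productVec v k := by
  funext x
  simp [productVec, Finset.prod_mul_distrib]

theorem productVec_ne_zero {v : Fin (D + 1) → ℂ} (hv : v ≠ 0) (k : ℕ) : productVec v k ≠ 0 := by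
  rw [ne_eq, ← dotProduct_star_self_eq_zero, star_productVec_dotProduct]
  exact pow_ne_zero k (dotProduct_star_self_eq_zero.not.2 hv)

theorem pureState_smul {N : ℕ} {c : ℂ} (hc : c ≠ 0) (φ : Hilb D N) (O : Op D N) :
    pureState (c • φ) O = pureState φ O := by
  have hc' : c * star c ≠ 0 := mul_ne_zero hc (star_ne_zero.2 hc)
  change star (c • φ) ⬝ᵥ O *ᵥ (c • φ) / (star (c • φ) ⬝ᵥ (c • φ)) =
    star φ ⬝ᵥ O *ᵥ φ / (star φ ⬝ᵥ φ)
  simp only [star_smul, Matrix.mulVec_smul, smul_dotProduct, dotProduct_smul,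
    smul_eq_mul, ← mul_assoc]
  exact mul_div_mul_left _ _ hc'

theorem zeroEntState_mk {v : Fin (D + 1) → ℂ} (hv : v ≠ 0) (k : ℕ) (O : Op D k) :
    zeroEntState (Projectivization.mk ℂ v hv) k O = pureState (productVec v k) O := by
  obtain ⟨a, ha⟩ := Projectivization.exists_smul_eq_mk_rep ℂ v hv
  rw [zeroEntState, ← ha, Units.smul_def, productVec_smul, pureState_smul (pow_ne_zero k a.ne_zero)]

theorem pureState_single {N : ℕ} (φ : Hilb D N) (x y : Config D (Fin N)) :
    pureState φ (Matrix.single y x 1) = density φ x y := by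
  change star φ ⬝ᵥ Matrix.single y x 1 *ᵥ φ / (star φ ⬝ᵥ φ) = _
  have h : star φ ⬝ᵥ Matrix.single y x (1 : ℂ) *ᵥ φ = φ x * star (φ y) := by
    rw [Matrix.single_mulVec, one_mul]
    refine (dotProduct_single (star φ) (φ x) y).trans (mul_comm _ _)
  rw [h, div_eq_inv_mul]
  rfl

/-- The topology is coinduced from the nonzero vectors, where independence of the representative
exhibits the state as a quotient of continuous functions with nonvanishing denominator. -/
theorem continuous_zeroEntState (k : ℕ) (O : Op D k) :
    Continuous fun v : CP D => zeroEntState v k O := by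
  refine continuous_coinduced_dom.2 ?_
  have h : (fun v : CP D => zeroEntState v k O) ∘ Projectivization.mk' ℂ =
      fun v : {v : Fin (D + 1) → ℂ // v ≠ 0} => star (productVec v.1 k) ⬝ᵥ O *ᵥ productVec v.1 k /
        (star (productVec v.1 k) ⬝ᵥ productVec v.1 k) :=
    funext fun v => zeroEntState_mk v.2 k O
  rw [h]
  have hc : Continuous fun v : {v : Fin (D + 1) → ℂ // v ≠ 0} => productVec v.1 k :=
    continuous_pi fun x => continuous_finsetProd _ fun j _ =>
      (continuous_apply (x j)).comp continuous_subtype_val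
  refine Continuous.div ?_ ?_ fun v => ?_
  · exact hc.star.dotProduct (continuous_const.matrix_mulVec hc)
  · exact hc.star.dotProduct hc
  · exact dotProduct_star_self_eq_zero.not.2 (productVec_ne_zero v.2 k)

theorem density_posSemidef {N : ℕ} (φ : Hilb D N) : (density φ).PosSemidef :=
  (Matrix.posSemidef_vecMulVec_self_star φ).smul (inv_nonneg.2 (dotProduct_star_self_nonneg φ))

theorem density_trace {N : ℕ} {φ : Hilb D N} (hφ : φ ≠ 0) : (density φ).trace = 1 := by
  rw [density, Matrix.trace_smul, Matrix.trace_vecMulVec, dotProduct_comm φ, smul_eq_mul,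
    inv_mul_cancel₀]
  exact mt dotProduct_star_self_eq_zero.1 hφ

theorem zeroEntState_single (v : CP D) (k : ℕ) (x y : Config D (Fin k)) :
    zeroEntState v k (Matrix.single y x 1) = density (productVec v.rep k) x y :=
  pureState_single _ x y

theorem integrable_density (μ : Measure (CP D)) [IsFiniteMeasure μ] (k : ℕ)
    (x y : Config D (Fin k)) : Integrable (fun v : CP D => density (productVec v.rep k) x y) μ := by
  simp only [← zeroEntState_single]
  refine Integrable.of_bound (continuous_zeroEntState k _).aestronglyMeasurable 1
    (Eventually.of_forall fun v => ?_)
  rw [zeroEntState_single]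
  refine ((density_posSemidef _).norm_apply_le_trace x y).trans ?_
  rw [density_trace (productVec_ne_zero v.rep_nonzero k), Complex.one_re]

theorem UnitSphere.ofLp_ne_zero (s : UnitSphere D) : s.1.ofLp ≠ 0 := by
  have h : s.1 ≠ 0 := ne_zero_of_mem_unit_sphere s
  simpa using h

/-- The projective point of a unit vector. -/
noncomputable def UnitSphere.toCP (s : UnitSphere D) : CP D :=
  Projectivization.mk' ℂ ⟨s.1.ofLp, s.ofLp_ne_zero⟩

theorem UnitSphere.continuous_toCP : Continuous (UnitSphere.toCP (D := D)) :=
  continuous_coinduced_rng.comp (by fun_prop)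

theorem UnitSphere.zeroEntState_toCP (s : UnitSphere D) (k : ℕ) (O : Op D k) :
    zeroEntState s.toCP k O = ∑ x, ∑ y, O y x * productFamily s.1.ofLp k x y := by
  have hs : star s.1.ofLp ⬝ᵥ s.1.ofLp = 1 := by
    rw [dotProduct_comm, ← EuclideanSpace.inner_eq_star_dotProduct, inner_self_eq_norm_sq_to_K,
      norm_eq_of_mem_sphere]
    simp
  refine (zeroEntState_mk s.ofLp_ne_zero k O).trans ?_
  change star (productVec s.1.ofLp k) ⬝ᵥ O *ᵥ productVec s.1.ofLp k / _ = _
  rw [star_productVec_dotProduct, hs, one_pow, div_one]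
  simp only [dotProduct, Matrix.mulVec, Finset.mul_sum]
  rw [Finset.sum_comm]
  refine Finset.sum_congr rfl fun x _ => Finset.sum_congr rfl fun y _ => ?_
  simp only [productVec, productFamily, Pi.star_apply, star_prod, Finset.prod_mul_distrib]
  ring

/-- The de Finetti measure on the unit sphere is pushed forward to projective space; agreement on
matrix units extends to all operators by linearity. -/
theorem exists_represents {ψ : LocalFunctional D} (hψ : limitFamily ψ ∈ boseStates D) :
    ∃ μ : Measure (CP D), IsProbabilityMeasure μ ∧ Represents μ ψ := by
  obtain ⟨μ, hμ⟩ := exists_mixture_eq hψ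
  have hmeas : Measurable (UnitSphere.toCP (D := D)) := UnitSphere.continuous_toCP.measurable
  refine ⟨(μ : Measure (UnitSphere D)).map UnitSphere.toCP,
    Measure.isProbabilityMeasure_map hmeas.aemeasurable, fun k O => ?_⟩
  have hint : ∀ x y, Integrable (fun s : UnitSphere D => productFamily s.1.ofLp k x y)
      (μ : Measure (UnitSphere D)) := fun x y => (BoundedContinuousFunction.mkOfCompact
        ⟨_, continuous_productFamily_sphere k x y⟩).integrable _
  rw [integral_map hmeas.aemeasurable (continuous_zeroEntState k O).aestronglyMeasurable]
  simp only [UnitSphere.zeroEntState_toCP]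
  rw [integral_finsetSum _ fun x _ => integrable_finsetSum _ fun y _ => (hint x y).const_mul _,
    eq_sum_limitFamily]
  refine Finset.sum_congr rfl fun x _ => ?_
  rw [integral_finsetSum _ fun y _ => (hint x y).const_mul _]
  refine Finset.sum_congr rfl fun y _ => ?_
  rw [integral_const_mul, ← hμ]
  rfl

end PermSymm

/-! ### Traces of matrix powers. -/

namespace Matrix

theorem submatrix_equiv_pow {m n R : Type*} [Fintype m] [DecidableEq m] [Fintype n] [DecidableEq n]
    [Semiring R] (M : Matrix n n R) (e : m ≃ n) (k : ℕ) :
    M.submatrix e e ^ k = (M ^ k).submatrix e e := by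
  induction k with
  | zero => simp
  | succ k ih => rw [pow_succ, ih, Matrix.submatrix_mul_equiv, pow_succ]

theorem trace_submatrix_equiv {m n R : Type*} [Fintype m] [Fintype n] [AddCommMonoid R]
    (M : Matrix n n R) (e : m ≃ n) : (M.submatrix e e).trace = M.trace :=
  e.sum_comp fun i => M i i

/-- The entries of a power of a matrix as sums over paths. -/
theorem pow_succ_apply_eq_sum {n R : Type*} [Fintype n] [DecidableEq n] [CommSemiring R]
    (M : Matrix n n R) (k : ℕ) (x y : n) :
    (M ^ (k + 1)) x y = ∑ s : Fin k → n, ∏ i : Fin (k + 1),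
      M (Fin.cons (α := fun _ => n) x s i) (Fin.snoc (α := fun _ => n) s y i) := by
  induction k generalizing x with
  | zero =>
    rw [Fintype.sum_unique]
    simp [Fin.snoc]
  | succ k ih =>
    rw [pow_succ', Matrix.mul_apply, ← (Fin.consEquiv fun _ => n).sum_comp, Fintype.sum_prod_type]
    refine Finset.sum_congr rfl fun a _ => ?_
    rw [ih, Finset.mul_sum]
    refine Finset.sum_congr rfl fun s _ => ?_
    have h : Fin.snoc (α := fun _ => n) (Fin.cons (α := fun _ => n) a s) y =
        Fin.cons (α := fun _ => n) a (Fin.snoc (α := fun _ => n) s y) :=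
      (Fin.cons_snoc_eq_snoc_cons a s y).symm
    change _ = ∏ i, M (Fin.cons (α := fun _ => n) x (Fin.cons (α := fun _ => n) a s) i)
      (Fin.snoc (α := fun _ => n) (Fin.cons (α := fun _ => n) a s) y i)
    rw [h, Fin.prod_univ_succ (n := k + 1)]
    simp only [Fin.cons_zero, Fin.cons_succ]

/-- The trace of a power of a matrix as a sum over closed paths. -/
theorem trace_pow_eq_sum_prod {ι R : Type*} [Fintype ι] [DecidableEq ι] [CommSemiring R]
    (M : Matrix ι ι R) {n : ℕ} (hn : n ≠ 0) :
    (M ^ n).trace = ∑ s : Fin n → ι, ∏ α, M (s α) (s (finRotate n α)) := by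
  obtain ⟨k, rfl⟩ := Nat.exists_eq_succ_of_ne_zero hn
  rw [Matrix.trace, ← (Fin.consEquiv fun _ => ι).sum_comp, Fintype.sum_prod_type]
  refine Finset.sum_congr rfl fun x _ => ?_
  rw [Matrix.diag_apply, pow_succ_apply_eq_sum]
  refine Finset.sum_congr rfl fun s _ => Finset.prod_congr rfl fun i _ => ?_
  rw [Fin.snoc_eq_cons_rotate]
  rfl

-- A positive semidefinite power of trace zero vanishes, so `M` would be nilpotent and itself have
-- trace zero.
open scoped ComplexOrder in
theorem PosSemidef.trace_pow_pos {ι : Type*} [Fintype ι] [DecidableEq ι] {M : Matrix ι ι ℂ}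
    (hM : M.PosSemidef) (htr : M.trace ≠ 0) (n : ℕ) : 0 < (M ^ n).trace := by
  refine lt_of_le_of_ne (hM.pow n).trace_nonneg fun h => htr ?_
  have h0 : M ^ n = 0 := (hM.pow n).trace_eq_zero_iff.1 h.symm
  exact (Matrix.isNilpotent_trace_of_isNilpotent ⟨n, h0⟩).eq_zero

end Matrix

/-! ### The replica integral and the limit of the entropies. -/

namespace PermSymm

open scoped ComplexOrder

variable {D : ℕ}

/-- Each overlap to the power `m` is an inner product of product vectors. Expanding it in the basis
and shifting the index of the kets by one replica collects all factors involving `v α` into one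
density matrix entry, so the variables separate. -/
theorem replicaIntegrand_eq_sum (n m : ℕ) (v : Fin n → CP D) :
    replicaIntegrand n m v = ∑ s : Fin n → Config D (Fin m),
      ∏ α, density (productVec (v α).rep m) (s ((finRotate n).symm α)) (s α) := by
  have hfac : replicaIntegrand n m v = ∏ α : Fin n,
      (∑ x, (star (productVec (v α).rep m) ⬝ᵥ productVec (v α).rep m)⁻¹ *
        (star (productVec (v α).rep m x) * productVec (v (finRotate n α)).rep m x)) := by
    rw [replicaIntegrand, ← Finset.prod_pow]
    refine Finset.prod_congr rfl fun α _ => ?_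
    rw [← Finset.mul_sum, div_pow, ← star_productVec_dotProduct, ← star_productVec_dotProduct,
      div_eq_inv_mul]
    rfl
  rw [hfac, Finset.prod_univ_sum, Fintype.piFinset_univ]
  refine Finset.sum_congr rfl fun s _ => ?_
  have hrot : ∏ α, productVec (v (finRotate n α)).rep m (s α) =
      ∏ α, productVec (v α).rep m (s ((finRotate n).symm α)) := by
    rw [← Equiv.prod_comp (finRotate n) fun α => productVec (v α).rep m (s ((finRotate n).symm α))]
    simp only [Equiv.symm_apply_apply]
  simp only [density, Matrix.smul_apply, Matrix.vecMulVec_apply, smul_eq_mul, Pi.star_apply,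
    Finset.prod_mul_distrib, hrot]
  ring

theorem integrable_prod_density (μ : Measure (CP D)) [IsFiniteMeasure μ] {n m : ℕ}
    (s t : Fin n → Config D (Fin m)) :
    Integrable (fun v : Fin n → CP D => ∏ α, density (productVec (v α).rep m) (s α) (t α))
      (Measure.pi fun _ : Fin n => μ) :=
  Integrable.fintype_prod (f := fun α (v : CP D) => density (productVec v.rep m) (s α) (t α))
    fun α => integrable_density μ m (s α) (t α)

theorem integrable_replicaIntegrand (μ : Measure (CP D)) [IsFiniteMeasure μ] (n m : ℕ) :
    Integrable (replicaIntegrand n m) (Measure.pi fun _ : Fin n => μ) := by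
  rw [show replicaIntegrand (D := D) n m = _ from funext (replicaIntegrand_eq_sum n m)]
  exact integrable_finsetSum _ fun s _ =>
    integrable_prod_density μ (fun α => s ((finRotate n).symm α)) s

/-- Fubini factorises each term of the expansion into entries of the limiting matrix, and the sum
over configurations is the closed-path expansion of the trace. -/
theorem integral_replicaIntegrand {μ : Measure (CP D)} [IsFiniteMeasure μ] {ψ : LocalFunctional D}
    (hμ : Represents μ ψ) {n : ℕ} (hn : n ≠ 0) (m : ℕ) :
    ∫ v, replicaIntegrand n m v ∂(Measure.pi fun _ : Fin n => μ) =
      (Matrix.of (limitFamily ψ m) ^ n).trace := by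
  simp only [replicaIntegrand_eq_sum]
  rw [integral_finsetSum _ fun s _ =>
    integrable_prod_density μ (fun α => s ((finRotate n).symm α)) s, Matrix.trace_pow_eq_sum_prod _ hn]
  refine Finset.sum_congr rfl fun s _ => ?_
  rw [integral_fintype_prod_eq_prod fun α (v : CP D) =>
    density (productVec v.rep m) (s ((finRotate n).symm α)) (s α), ← Equiv.prod_comp (finRotate n)]
  refine Finset.prod_congr rfl fun α _ => ?_
  rw [Equiv.symm_apply_apply, Matrix.of_apply, limitFamily, hμ]
  simp only [zeroEntState_single]

/-- By symmetry `A` may be replaced by the first `m` sites, up to a relabelling of the basis that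
does not affect traces of powers. -/
theorem reducedDensity_pow_trace {N m : ℕ} {A : Finset (Fin N)} (hA : A.card = m) (hm : m ≤ N)
    {φ : Hilb D N} (hφ : IsSymmetric φ) (n : ℕ) :
    (reducedDensity A φ ^ n).trace =
      (Matrix.of (marginalMatrix (initialLabelling hm) φ) ^ n).trace := by
  let e : Fin m ≃ {j // j ∈ A} := (Fintype.equivFinOfCardEq (by simpa using hA)).symm
  have h : Matrix.of (marginalMatrix (initialLabelling hm) φ) =
      (reducedDensity A φ).submatrix (Equiv.arrowCongr e (Equiv.refl (Fin (D + 1))))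
        (Equiv.arrowCongr e (Equiv.refl (Fin (D + 1)))) := by
    ext x y
    exact (marginalMatrix_eq _ _ hφ x y).trans (reducedDensity_eq_marginalMatrix e φ x y).symm
  rw [h, Matrix.submatrix_equiv_pow, Matrix.trace_submatrix_equiv]

theorem tendsto_reducedDensity_pow_trace {Φ : ∀ N : ℕ, Hilb D N}
    (hsymm : ∀ N : ℕ, 1 ≤ N → IsSymmetric (Φ N)) {ψ : LocalFunctional D}
    (hψ : ConvergesLocally Φ ψ) {m : ℕ} (n : ℕ) {A : ∀ N : ℕ, Finset (Fin N)}
    (hA : ∀ᶠ N in atTop, (A N).card = m) :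
    Tendsto (fun N => (reducedDensity (A N) (Φ N) ^ n).trace) atTop
      (𝓝 (Matrix.of (limitFamily ψ m) ^ n).trace) := by
  have hmat : Tendsto (fun N => Matrix.of fun x y =>
      if h : m ≤ N then marginalMatrix (initialLabelling h) (Φ N) x y else 0) atTop
      (𝓝 (Matrix.of (limitFamily ψ m))) :=
    tendsto_pi_nhds.2 fun x => tendsto_pi_nhds.2 fun y => tendsto_marginalMatrix hψ m x y
  have hcont : Continuous fun M : Op D m => (M ^ n).trace := (continuous_pow n).matrix_trace
  refine ((hcont.tendsto _).comp hmat).congr' ?_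
  filter_upwards [hA, eventually_ge_atTop m, eventually_ge_atTop 1] with N hN hm h1
  rw [reducedDensity_pow_trace hN hm (hsymm N h1), Function.comp_apply]
  simp only [dif_pos hm]

end PermSymm

theorem theorem2 (D : ℕ) (Φ : ∀ N : ℕ, PermSymm.Hilb D N)
    (hsymm : ∀ N : ℕ, 1 ≤ N → PermSymm.IsSymmetric (Φ N))
    (hne : ∀ N : ℕ, 1 ≤ N → Φ N ≠ 0)
    (ψ : PermSymm.LocalFunctional D) (hψ : PermSymm.ConvergesLocally Φ ψ) :
    (∃ μ : Measure (PermSymm.CP D), IsProbabilityMeasure μ ∧ PermSymm.Represents μ ψ) ∧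
    ∀ μ : Measure (PermSymm.CP D), IsProbabilityMeasure μ → PermSymm.Represents μ ψ →
      ∀ n : ℕ, 1 < n → ∀ m : ℕ,
        Integrable (PermSymm.replicaIntegrand n m)
          (Measure.pi fun _ : Fin n => μ) ∧
        ∃ I : ℝ, 0 < I ∧
          ∫ v, PermSymm.replicaIntegrand n m v ∂(Measure.pi fun _ : Fin n => μ) = (I : ℂ) ∧
          ∀ A : ∀ N : ℕ, Finset (Fin N), (∀ᶠ N in atTop, (A N).card = m) →
            Tendsto (fun N : ℕ => PermSymm.renyi n (A N) (Φ N)) atTop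
              (𝓝 (1 / (1 - (n : ℝ)) * Real.log I)) := by
  have hbose := PermSymm.limitFamily_mem_boseStates hsymm hne hψ
  refine ⟨PermSymm.exists_represents hbose, fun μ _ hμ n hn m =>
    ⟨PermSymm.integrable_replicaIntegrand μ n m,
      (Matrix.of (PermSymm.limitFamily ψ m) ^ n).trace.re, ?_⟩⟩
  have hpos := (hbose.1.posSemidef m).trace_pow_pos
    (by rw [hbose.1.trace_eq, hbose.2]; exact one_ne_zero) n
  obtain ⟨hre, him⟩ := Complex.lt_def.1 hpos
  refine ⟨hre, ?_, fun A hA => ?_⟩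
  · rw [PermSymm.integral_replicaIntegrand hμ (by lia)]
    exact Complex.ext rfl him.symm
  · have ht := PermSymm.tendsto_reducedDensity_pow_trace hsymm hψ n hA
    -- Positivity of the limiting trace is what permits passing to the limit inside the logarithm.
    have hlog := (((Complex.continuous_re.tendsto _).comp ht).log hre.ne').div_const (1 - (n : ℝ))
    rw [one_div_mul_eq_div]
    exact hlog
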